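/- Let $\Omega\subset\mathbb R^2$ be a domain (a non-empty connected open set). A mesh of $\Omega$ is a finite set $\mathcal M$ of closed polygons (each a compact region bounded by a simple closed polygonal curve) with pairwise disjoint interiors, whose union is $\overline\Omega$ and such that $\partial\Omega$ is contained in the union of the boundaries of the elements $E\in\mathcal M$. A finite element pair $(H,V)$ on $\mathcal M$ consists of a linear space $H$ of functions that are continuous on $\Omega$ and agree with a polynomial in the interior of each element, and a linear space $V$ of vector fields whose two components agree with polynomials in the interior of each element (no continuity across element boundaries is required). All gradients are taken pointwise in the interiors of the elements, and $\|\cdot\|$ denotes the $L^2(\Omega)$-norm. Theorem (Inf-sup theorem). There is a constant $\beta>0$, depending only on $\Omega$, such that for every mesh $\mathcal M$ of $\Omega$ and every finite element pair $(H,V)$ on $\mathcal M$ with $\nabla\phi\in V$ for all $\phi\in H$, $$\sup_{w\in V}\frac{\int_\Omega w\cdot\nabla\phi\,dx}{\|w\|}\;\ge\;\beta\,\|\phi-\bar\phi\|\qquad\text{for all }\phi\in H,\qquad \bar\phi=\frac1{|\Omega|}\int_\Omega\phi\,dx,$$ where the supremum is finite and the quotient is read as $0$ if $\|w\|=0$.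 In particular, for all $\phi\in H$ with $\int_\Omega\phi\,dx=0$ the right-hand side is $\beta\|\phi\|$. The constant $\beta$ does not depend on the edge lengths, on any other feature of the mesh, or on the polynomial degrees. -/

import Mathlib

open MeasureTheory

noncomputable section

/-- The Euclidean plane. -/
abbrev Plane : Type := EuclideanSpace ℝ (Fin 2)

/-- The boundary of the polygon is a simple closed curve: the closed path which runs once along
all edges (each edge without its final vertex) visits no point twice. -/
def Polygon.IsSimple {n : ℕ} (poly : Polygon Plane n) : Prop :=
  Function.Injective
    (fun p : Fin n × Set.Ico (0 : ℝ) 1 => poly.edgePath ℝ p.1 (p.2 : ℝ))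

/-- A closed (filled) polygon: a compact region with interior points which is bounded by a simple
closed polygonal curve. It need not be convex. -/
structure IsPolygonalElement (E : Set Plane) : Prop where
  compact : IsCompact E
  interior_nonempty : (interior E).Nonempty
  polygonal_frontier :
    ∃ (n : ℕ) (poly : Polygon Plane n), 3 ≤ n ∧ poly.IsSimple ∧ frontier E = poly.boundary ℝ

/-- `M` is a finite element mesh of `Ω`: finitely many non-overlapping polygons which completely
cover `Ω`, such that the boundary of `Ω` consists of boundary pieces of the elements. No shape
regularity, no bound on the edge lengths and no conformity (absence of hanging nodes) is
required. -/
structure IsMesh (Ω : Set Plane) (M : Set (Set Plane)) : Prop where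
  finite : M.Finite
  polygon : ∀ E ∈ M, IsPolygonalElement E
  nonoverlapping : M.Pairwise (fun E F => Disjoint (interior E) (interior F))
  cover : ⋃₀ M = closure Ω
  polygonal_boundary : frontier Ω ⊆ ⋃ E ∈ M, frontier E

/-- A scalar function which agrees in the interior of every element with a polynomial. The
polynomial and its degree may differ from element to element. -/
def IsElementwisePoly (M : Set (Set Plane)) (φ : Plane → ℝ) : Prop :=
  ∀ E ∈ M, ∃ p : MvPolynomial (Fin 2) ℝ, ∀ x ∈ interior E, φ x = MvPolynomial.eval (fun i => x i) p

/-- A finite element pair on the mesh `M` of `Ω`: `H` is a linear space of elementwise polynomials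
that are continuous across element boundaries, `V` is a linear space of vectors of elementwise
polynomials without any continuity requirement. -/
structure IsFiniteElementPair (Ω : Set Plane) (M : Set (Set Plane))
    (H : Submodule ℝ (Plane → ℝ)) (V : Submodule ℝ (Plane → Plane)) : Prop where
  pressure_poly : ∀ φ ∈ H, IsElementwisePoly M φ
  pressure_continuous : ∀ φ ∈ H, ContinuousOn φ Ω
  velocity_poly : ∀ w ∈ V, ∀ i : Fin 2, IsElementwisePoly M (fun x => w x i)

/-- The embedding condition: the pointwise gradient maps `H` into `V`. The gradient of a function
in `H` is an elementwise polynomial vector field, defined inside the elements. -/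
def GradientEmbeds (M : Set (Set Plane))
    (H : Submodule ℝ (Plane → ℝ)) (V : Submodule ℝ (Plane → Plane)) : Prop :=
  ∀ φ ∈ H, ∃ q ∈ V, ∀ E ∈ M, ∀ x ∈ interior E, q x = gradient φ x

/-- The `L²` norm on `Ω`. -/
def l2Norm {F : Type*} [NormedAddCommGroup F] (Ω : Set Plane) (f : Plane → F) : ℝ :=
  Real.sqrt (∫ x in Ω, ‖f x‖ ^ 2)

/-- The quotient `(∫_Ω w · ∇φ) / ‖w‖`. It is `0` where `w` vanishes almost everywhere in `Ω`. -/
def infSupQuotient (Ω : Set Plane) (φ : Plane → ℝ) (w : Plane → Plane) : ℝ :=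
  (∫ x in Ω, inner ℝ (w x) (gradient φ x)) / l2Norm Ω w

/-- The inf-sup condition with constant `β`. The norm of `φ` is taken modulo constants, that is,
`φ` is replaced by `φ` minus its mean over `Ω`; for `φ` of mean zero this is the norm of `φ`.
The supremum is a genuine (finite) one. -/
def InfSupCondition (Ω : Set Plane)
    (H : Submodule ℝ (Plane → ℝ)) (V : Submodule ℝ (Plane → Plane)) (β : ℝ) : Prop :=
  ∀ φ ∈ H,
    BddAbove (Set.range fun w : V => infSupQuotient Ω φ (w : Plane → Plane)) ∧
      β * l2Norm Ω (fun x => φ x - ⨍ y in Ω, φ y) ≤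
        ⨆ w : V, infSupQuotient Ω φ (w : Plane → Plane)

end

/-! Testing with the field `q ∈ V` that equals `∇φ` inside the elements gives the quotient `‖∇φ‖`,
and Cauchy–Schwarz bounds every quotient by the same number. What remains is the Poincaré inequality
for `φ` modulo constants, with a constant that sees only `Ω`.

It is proved for all continuous functions having a bounded gradient off finitely many lines
(`HasPiecewiseGradient`). Neither these lines nor the gradient bound enter the constant, so mesh and
degrees disappear. A mesh serves only to show that `Ω` is bounded and that its frontier lies on
finitely many lines; any one mesh suffices.

The lines cut `Ω`, up to a null set, into finitely many open convex cells (`exists_convex_cells`),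
so no regularity of the boundary is needed. On a convex set, integrating the gradient along segments
gives the inequality (`poincareOn_of_convex`). Inequalities on overlapping open sets combine
(`PoincareOn.union`), and connectedness links the cells to a base ball
(`exists_poincareOn_of_isPreconnected`). -/

open Set Topology
open scoped ENNReal NNReal RealInnerProductSpace

/-! ### Finite unions of lines -/

/-- The union of the lines `{x | p.1 x = p.2}`, `p ∈ T`. -/
def lineUnion (T : Finset ((Plane →L[ℝ] ℝ) × ℝ)) : Set Plane :=
  {x | ∃ p ∈ T, p.1 x = p.2}

theorem volume_lineUnion {T : Finset ((Plane →L[ℝ] ℝ) × ℝ)} (hT : ∀ p ∈ T, p.1 ≠ 0) :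
    volume (lineUnion T) = 0 := by
  have : lineUnion T = ⋃ p ∈ T, {x | p.1 x = p.2} := by
    ext x; simp [lineUnion]
  rw [this]
  refine (measure_biUnion_null_iff T.countable_toSet).2 ?_
  intro p hp
  obtain ⟨v, hv⟩ : ∃ v, p.1 v ≠ 0 := by
    by_contra! h
    exact hT p hp (ContinuousLinearMap.ext h)
  have hker : volume ((LinearMap.ker p.1.toLinearMap : Submodule ℝ Plane) : Set Plane) = 0 := by
    apply Measure.addHaar_submodule
    intro h
    exact hv (by simpa using (h ▸ Submodule.mem_top : v ∈ LinearMap.ker p.1.toLinearMap))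
  rw [← measure_preimage_add volume ((p.2 / p.1 v) • v)]
  convert hker using 2
  ext x
  simp [hv]

/-- A line through a point off `p.1 = p.2` is not contained in that line, hence meets it at most
once. -/
theorem finite_segment_inter_lineUnion (T : Finset ((Plane →L[ℝ] ℝ) × ℝ)) {y : Plane}
    (hy : y ∉ lineUnion T) (v : Plane) : {t : ℝ | y + t • v ∈ lineUnion T}.Finite := by
  have : {t : ℝ | y + t • v ∈ lineUnion T} = ⋃ p ∈ T, {t : ℝ | p.1 (y + t • v) = p.2} := by
    ext x; simp [lineUnion]
  rw [this]
  refine T.finite_toSet.biUnion fun p hp => Set.Subsingleton.finite ?_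
  intro s hs t ht
  simp only [mem_ofPred_eq, map_add, map_smul, smul_eq_mul] at hs ht
  have hy' : p.1 y ≠ p.2 := fun h => hy ⟨p, hp, h⟩
  have hv : p.1 v ≠ 0 := fun h => hy' (by simpa [h] using hs)
  exact mul_right_cancel₀ hv (by linarith)

/-- Two points of the plane lie on a common line. -/
theorem exists_line_through (p q : Plane) :
    ∃ a : Plane →L[ℝ] ℝ, a ≠ 0 ∧ a p = a q := by
  by_cases h : p = q
  · refine ⟨EuclideanSpace.proj 0, fun h0 => ?_, by rw [h]⟩
    simpa using DFunLike.congr_fun h0 (EuclideanSpace.single 0 (1 : ℝ))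
  · refine ⟨(q 1 - p 1) • EuclideanSpace.proj 0 - (q 0 - p 0) • EuclideanSpace.proj 1,
      fun h0 => h ?_, ?_⟩
    · have h1 := DFunLike.congr_fun h0 (EuclideanSpace.single 0 (1 : ℝ))
      have h2 := DFunLike.congr_fun h0 (EuclideanSpace.single 1 (1 : ℝ))
      simp at h1 h2
      ext i
      fin_cases i
      · simp; linarith
      · simp; linarith
    · simp
      ring

theorem Polygon.exists_boundary_subset_lineUnion {n : ℕ} (poly : Polygon Plane n) :
    ∃ T : Finset ((Plane →L[ℝ] ℝ) × ℝ), (∀ p ∈ T, p.1 ≠ 0) ∧ poly.boundary ℝ ⊆ lineUnion T := by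
  classical
  choose a ha0 ha using fun i : Fin n => exists_line_through (poly i) (poly (finRotate n i))
  refine ⟨Finset.univ.image fun i => (a i, a i (poly i)), ?_, ?_⟩
  · intro p hp
    obtain ⟨i, -, rfl⟩ := Finset.mem_image.1 hp
    exact ha0 i
  · intro x hx
    obtain ⟨i, hi⟩ := mem_iUnion.1 hx
    obtain ⟨t, -, rfl⟩ := hi
    refine ⟨_, Finset.mem_image_of_mem _ (Finset.mem_univ i), ?_⟩
    change a i (AffineMap.lineMap (poly i) (poly (finRotate n i)) t) = a i (poly i)
    rw [AffineMap.lineMap_apply, vsub_eq_sub, vadd_eq_add, map_add, map_smul, map_sub, ← ha i]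
    simp

theorem IsMesh.exists_frontier_subset_lineUnion {Ω : Set Plane} {M : Set (Set Plane)}
    (hM : IsMesh Ω M) :
    ∃ T : Finset ((Plane →L[ℝ] ℝ) × ℝ), (∀ p ∈ T, p.1 ≠ 0) ∧
      ∀ E ∈ M, frontier E ⊆ lineUnion T := by
  classical
  have h : ∀ E : M, ∃ T : Finset ((Plane →L[ℝ] ℝ) × ℝ), (∀ p ∈ T, p.1 ≠ 0) ∧
      frontier (E : Set Plane) ⊆ lineUnion T := by
    intro E
    obtain ⟨n, poly, -, -, hE⟩ := (hM.polygon E E.2).polygonal_frontier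
    rw [hE]
    exact poly.exists_boundary_subset_lineUnion
  choose T hT0 hT using h
  have := hM.finite.fintype
  refine ⟨Finset.univ.biUnion T, ?_, ?_⟩
  · intro p hp
    obtain ⟨E, -, hE⟩ := Finset.mem_biUnion.1 hp
    exact hT0 E p hE
  · intro E hE x hx
    obtain ⟨p, hp, hpx⟩ := hT ⟨E, hE⟩ hx
    exact ⟨p, Finset.mem_biUnion.2 ⟨_, Finset.mem_univ _, hp⟩, hpx⟩

/-- An open set whose frontier lies on finitely many lines is, up to these lines, a finite union
of convex open sets. -/
theorem exists_convex_cells {Ω : Set Plane} (hΩ : IsOpen Ω) {T : Finset ((Plane →L[ℝ] ℝ) × ℝ)}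
    (hT : frontier Ω ⊆ lineUnion T) :
    ∃ P : Set (Set Plane), P.Finite ∧
      (∀ U ∈ P, IsOpen U ∧ Convex ℝ U ∧ U.Nonempty ∧ U ⊆ Ω) ∧ Ω ⊆ ⋃₀ P ∪ lineUnion T := by
  classical
  let cell : Finset ((Plane →L[ℝ] ℝ) × ℝ) → Set Plane := fun s =>
    ⋂ p ∈ T, if p ∈ s then {x | p.1 x < p.2} else {x | p.2 < p.1 x}
  have hopen : ∀ s, IsOpen (cell s) := by
    intro s
    refine T.finite_toSet.isOpen_biInter fun p _ => ?_
    split_ifs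
    · exact isOpen_lt p.1.continuous continuous_const
    · exact isOpen_lt continuous_const p.1.continuous
  have hconv : ∀ s, Convex ℝ (cell s) := by
    intro s
    refine convex_iInter₂ fun p _ => ?_
    split_ifs
    · exact convex_halfSpace_lt p.1.isLinear _
    · exact convex_halfSpace_gt p.1.isLinear _
  have hdisj : ∀ s, ∀ x ∈ cell s, x ∉ lineUnion T := by
    rintro s x hx ⟨p, hp, h⟩
    have := mem_iInter₂.1 hx p hp
    split_ifs at this
    · exact this.ne h
    · exact this.ne' h
  refine ⟨{U | ∃ s ∈ T.powerset, U = cell s ∧ (cell s ∩ Ω).Nonempty}, ?_, ?_, ?_⟩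
  · refine (T.powerset.finite_toSet.image cell).subset ?_
    rintro U ⟨s, hs, rfl, -⟩
    exact ⟨s, hs, rfl⟩
  · rintro U ⟨s, -, rfl, hne⟩
    refine ⟨hopen s, hconv s, hne.left, ?_⟩
    -- A cell is connected and avoids the frontier of `Ω`, so it lies inside `Ω` as soon as it meets
    -- `Ω`.
    refine (hconv s).isPreconnected.subset_of_closure_inter_subset hΩ hne ?_
    rintro x ⟨hx, hxs⟩
    by_contra hxΩ
    exact hdisj s x hxs (hT ⟨hx, by rwa [hΩ.interior_eq]⟩)
  · intro x hx
    by_cases hxT : x ∈ lineUnion T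
    · exact Or.inr hxT
    · have hxc : x ∈ cell (T.filter fun p => p.1 x < p.2) := by
        refine mem_iInter₂.2 fun p hp => ?_
        split_ifs with h
        · exact (Finset.mem_filter.1 h).2
        · have h1 : ¬ p.1 x < p.2 := fun h' => h (Finset.mem_filter.2 ⟨hp, h'⟩)
          exact lt_of_le_of_ne (not_lt.1 h1) fun h' => hxT ⟨p, hp, h'.symm⟩
      exact Or.inl ⟨_, ⟨_, Finset.mem_powerset.2 (Finset.filter_subset _ _), rfl, x, hxc, hx⟩, hxc⟩

/-! ### The Poincaré inequality on convex sets -/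

theorem lintegral_sq_le_lintegral_sq {α : Type*} [MeasurableSpace α] (μ : Measure α)
    [IsProbabilityMeasure μ] {f : α → ℝ≥0∞} (hf : AEMeasurable f μ) :
    (∫⁻ a, f a ∂μ) ^ 2 ≤ ∫⁻ a, f a ^ 2 ∂μ := by
  have h := ENNReal.lintegral_mul_le_Lp_mul_Lq μ Real.HolderConjugate.two_two hf
    (aemeasurable_const (b := (1 : ℝ≥0∞)))
  simp only [Pi.mul_apply, mul_one, ENNReal.one_rpow, lintegral_const, measure_univ] at h
  calc (∫⁻ a, f a ∂μ) ^ 2 ≤ ((∫⁻ a, f a ^ (2 : ℝ) ∂μ) ^ (1 / 2 : ℝ)) ^ 2 := by gcongr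
    _ = ∫⁻ a, f a ^ 2 ∂μ := by
      rw [← ENNReal.rpow_natCast, ← ENNReal.rpow_mul]
      simp

/-- Fundamental theorem of calculus off a countable set, then Cauchy–Schwarz. The bound `K` only
secures integrability and does not enter the estimate. The proof works with `deriv f`, which is
measurable and equals `g` almost everywhere. -/
theorem enorm_sub_sq_le_lintegral_deriv {f g : ℝ → ℝ} {s : Set ℝ} {K : ℝ} (hs : s.Countable)
    (hf : ContinuousOn f (Icc 0 1)) (hfg : ∀ t ∈ Ioo (0 : ℝ) 1 \ s, HasDerivAt f (g t) t)
    (hg : ∀ t ∈ Ioo (0 : ℝ) 1 \ s, ‖g t‖ ≤ K) :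
    ‖f 1 - f 0‖ₑ ^ 2 ≤ ∫⁻ t in Icc (0 : ℝ) 1, ‖g t‖ₑ ^ 2 := by
  have hae : ∀ᵐ t ∂volume.restrict (Ioc (0 : ℝ) 1), t ∈ Ioo (0 : ℝ) 1 \ s := by
    have h0 : ∀ᵐ t : ℝ, t ∉ s ∪ {1} :=
      compl_mem_ae_iff.2 ((hs.union (countable_singleton 1)).measure_zero _)
    filter_upwards [ae_restrict_of_ae h0, ae_restrict_mem measurableSet_Ioc] with t ht ht'
    simp only [mem_union, mem_singleton_iff, not_or] at ht
    exact ⟨⟨ht'.1, lt_of_le_of_ne ht'.2 ht.2⟩, ht.1⟩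
  have hint : IntervalIntegrable (deriv f) volume 0 1 := by
    rw [intervalIntegrable_iff_integrableOn_Ioc_of_le zero_le_one]
    refine Measure.integrableOn_of_bounded (M := K) (by simp)
      (measurable_deriv f).aestronglyMeasurable ?_
    filter_upwards [hae] with t ht
    rw [(hfg t ht).deriv]
    exact hg t ht
  have hFTC := integral_eq_of_hasDerivAt_off_countable f (deriv f) (a := 0) (b := 1) hs
    (by rwa [uIcc_of_le zero_le_one])
    (fun t ht => by
      rw [min_eq_left zero_le_one, max_eq_right zero_le_one] at ht
      exact (hfg t ht).differentiableAt.hasDerivAt) hint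
  have : IsProbabilityMeasure (volume.restrict (Ioc (0 : ℝ) 1)) := ⟨by simp⟩
  rw [← hFTC, intervalIntegral.integral_of_le zero_le_one]
  calc ‖∫ t in Ioc (0 : ℝ) 1, deriv f t‖ₑ ^ 2
      ≤ (∫⁻ t in Ioc (0 : ℝ) 1, ‖deriv f t‖ₑ) ^ 2 := by
        gcongr
        exact enorm_integral_le_lintegral_enorm _
    _ ≤ ∫⁻ t in Ioc (0 : ℝ) 1, ‖deriv f t‖ₑ ^ 2 :=
        lintegral_sq_le_lintegral_sq _ (measurable_deriv f).enorm.aemeasurable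
    _ = ∫⁻ t in Ioc (0 : ℝ) 1, ‖g t‖ₑ ^ 2 := by
        refine lintegral_congr_ae ?_
        filter_upwards [hae] with t ht
        rw [(hfg t ht).deriv]
    _ ≤ ∫⁻ t in Icc (0 : ℝ) 1, ‖g t‖ₑ ^ 2 := lintegral_mono_set Ioc_subset_Icc_self

/-- `φ` is continuous on `Ω` and, off finitely many lines, differentiable with a bounded
gradient. -/
structure HasPiecewiseGradient (Ω : Set Plane) (φ : Plane → ℝ) : Prop where
  continuousOn : ContinuousOn φ Ω
  exists_bound : ∃ T : Finset ((Plane →L[ℝ] ℝ) × ℝ), (∀ p ∈ T, p.1 ≠ 0) ∧ ∃ K : ℝ,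
    ∀ x ∈ Ω, x ∉ lineUnion T → DifferentiableAt ℝ φ x ∧ ‖gradient φ x‖ ≤ K

theorem measurable_gradient (φ : Plane → ℝ) : Measurable (gradient φ) := by
  have : gradient φ = fun x => (InnerProductSpace.toDual ℝ Plane).symm (fderiv ℝ φ x) := rfl
  rw [this]
  exact (InnerProductSpace.toDual ℝ Plane).symm.continuous.measurable.comp (measurable_fderiv ℝ φ)

/-- If `y` avoids the exceptional lines, every segment from `y` crosses them finitely often,
whatever its other end `x` is. So the null set of bad `y` does not depend on `x`. -/
theorem HasPiecewiseGradient.enorm_sub_sq_le {Ω U : Set Plane} {φ : Plane → ℝ}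
    (hφ : HasPiecewiseGradient Ω φ) (hU : Convex ℝ U) (hUΩ : U ⊆ Ω) {d : ℝ≥0}
    (hd : ∀ x ∈ U, ∀ y ∈ U, ‖x - y‖ₑ ≤ d) :
    ∀ᵐ y, y ∈ U → ∀ x ∈ U, ‖φ x - φ y‖ₑ ^ 2 ≤
      d ^ 2 * ∫⁻ t in Icc (0 : ℝ) 1, ‖gradient φ (y + t • (x - y))‖ₑ ^ 2 := by
  obtain ⟨T, hT0, K, hK⟩ := hφ.exists_bound
  have hN : ∀ᵐ y, y ∉ lineUnion T := compl_mem_ae_iff.2 (volume_lineUnion hT0)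
  filter_upwards [hN] with y hyT hy x hx
  have hmem : ∀ t ∈ Icc (0 : ℝ) 1, y + t • (x - y) ∈ U := fun t ht =>
    hU.add_smul_sub_mem hy hx ht
  have hcont : Continuous fun t : ℝ => y + t • (x - y) := by fun_prop
  have key := enorm_sub_sq_le_lintegral_deriv (f := fun t => φ (y + t • (x - y)))
    (g := fun t => ⟪gradient φ (y + t • (x - y)), x - y⟫)
    (s := {t : ℝ | y + t • (x - y) ∈ lineUnion T}) (K := K * ‖x - y‖)
    (finite_segment_inter_lineUnion T hyT (x - y)).countable
    (hφ.continuousOn.comp hcont.continuousOn fun t ht => hUΩ (hmem t ht))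
    (fun t ht => by
      have h1 := (hK _ (hUΩ (hmem t (Ioo_subset_Icc_self ht.1))) ht.2).1.hasGradientAt.hasFDerivAt
      have h2 : HasDerivAt (fun t : ℝ => y + t • (x - y)) (x - y) t := by
        simpa using ((hasDerivAt_id t).smul_const (x - y)).const_add y
      exact h1.comp_hasDerivAt (f := fun t : ℝ => y + t • (x - y)) t h2)
    (fun t ht => by
      refine (norm_inner_le_norm _ _).trans ?_
      gcongr
      exact (hK _ (hUΩ (hmem t (Ioo_subset_Icc_self ht.1))) ht.2).2)
  have h1 : y + (1 : ℝ) • (x - y) = x := by simp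
  have h0 : y + (0 : ℝ) • (x - y) = y := by simp
  simp only [h1, h0] at key
  refine key.trans ?_
  rw [← lintegral_const_mul' _ _ (by finiteness)]
  refine lintegral_mono fun t => ?_
  rw [← mul_pow]
  gcongr
  calc ‖⟪gradient φ (y + t • (x - y)), x - y⟫‖ₑ
      ≤ ‖gradient φ (y + t • (x - y))‖ₑ * ‖x - y‖ₑ := by
        simp only [enorm_eq_nnnorm]
        exact_mod_cast nnnorm_inner_le_nnnorm _ _
    _ ≤ d * ‖gradient φ (y + t • (x - y))‖ₑ := by
        rw [mul_comm]
        gcongr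
        exact hd x hx y hy

/-- Substitution `x ↦ z + t x` in the plane for `t ≥ 1 / 2`. -/
theorem lintegral_add_smul_le {h : Plane → ℝ≥0∞} (hh : Measurable h) (z : Plane) {t : ℝ}
    (ht : 1 / 2 ≤ t) : ∫⁻ x, h (z + t • x) ≤ 4 * ∫⁻ x, h x := by
  have ht0 : 0 < t := by linarith
  have h1 : ∫⁻ x, h (z + t • x) = ∫⁻ x, h (z + x) ∂(Measure.map (fun x => t • x) volume) := by
    rw [lintegral_map (by fun_prop) (by fun_prop)]
  rw [h1, Measure.map_addHaar_smul volume ht0.ne', lintegral_smul_measure,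
    lintegral_add_left_eq_self, smul_eq_mul]
  gcongr
  have h4 : (4 : ℝ≥0∞) = ENNReal.ofReal 4 := by norm_num
  rw [h4]
  refine ENNReal.ofReal_le_ofReal ?_
  -- The Jacobian factor in dimension two is `t⁻²`, at most `4` for `t ≥ 1 / 2`.
  rw [finrank_euclideanSpace_fin, abs_of_pos (by positivity)]
  rw [inv_le_comm₀ (by positivity) (by norm_num)]
  nlinarith

/-- One of the weights in `(1 - t) y + t x` is at least `1 / 2`. Substituting in the variable that
carries it costs a factor `4` uniformly in `t`; the other variable contributes `volume U`. -/
theorem lintegral_lintegral_segment_le {U : Set Plane} {h : Plane → ℝ≥0∞} (hh : Measurable h)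
    (t : ℝ) :
    ∫⁻ y in U, ∫⁻ x in U, h (y + t • (x - y)) ≤ volume U * (4 * ∫⁻ x, h x) := by
  have hcongr : ∀ x y : Plane, y + t • (x - y) = (1 - t) • y + t • x := fun x y => by
    rw [smul_sub, sub_smul, one_smul]; abel
  have hconst : ∀ F : Plane → ℝ≥0∞, (∀ y, F y ≤ 4 * ∫⁻ x, h x) →
      ∫⁻ y in U, F y ≤ volume U * (4 * ∫⁻ x, h x) := fun F hF => by
    refine (lintegral_mono hF).trans ?_
    rw [setLIntegral_const, mul_comm]
  simp only [hcongr]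
  rcases le_total (1 / 2) t with ht | ht
  · exact hconst _ fun y => (setLIntegral_le_lintegral _ _).trans (lintegral_add_smul_le hh _ ht)
  · have hm : Measurable (Function.uncurry fun y x : Plane => h ((1 - t) • y + t • x)) :=
      hh.comp (by fun_prop : Measurable fun p : Plane × Plane => (1 - t) • p.1 + t • p.2)
    rw [lintegral_lintegral_swap hm.aemeasurable]
    refine hconst _ fun x => (setLIntegral_le_lintegral _ _).trans ?_
    simp only [add_comm _ (t • x)]
    exact lintegral_add_smul_le hh _ (by linarith)

/-- The Poincaré inequality on `S ⊆ Ω`, modulo constants, with the gradient measured on `Ω`. -/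
def PoincareOn (Ω S : Set Plane) : Prop :=
  ∃ C : ℝ≥0, ∀ φ, HasPiecewiseGradient Ω φ → ∃ c : ℝ,
    ∫⁻ x in S, ‖φ x - c‖ₑ ^ 2 ≤ C * ∫⁻ x in Ω, ‖gradient φ x‖ₑ ^ 2

theorem poincareOn_of_convex {Ω U : Set Plane} (hU : IsOpen U) (hconv : Convex ℝ U)
    (hne : U.Nonempty) (hb : Bornology.IsBounded U) (hUΩ : U ⊆ Ω) : PoincareOn Ω U := by
  obtain ⟨D, hD⟩ := Metric.isBounded_iff.1 hb
  set d : ℝ≥0 := D.toNNReal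
  have hd : ∀ x ∈ U, ∀ y ∈ U, ‖x - y‖ₑ ≤ d := by
    intro x hx y hy
    rw [← ofReal_norm, ← dist_eq_norm]
    exact ENNReal.ofReal_le_ofReal (hD hx hy)
  have hvol0 : volume U ≠ 0 := (hU.measure_pos volume hne).ne'
  have hvol : volume U ≠ ∞ := hb.measure_lt_top.ne
  -- `d` bounds the diameter of `U`; the `4` comes from the substitution along segments.
  refine ⟨d ^ 2 * 4, fun φ hφ => ?_⟩
  set G := ∫⁻ x in Ω, ‖gradient φ x‖ₑ ^ 2
  set h : Plane → ℝ≥0∞ := U.indicator fun x => ‖gradient φ x‖ₑ ^ 2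
  have hh : Measurable h := ((measurable_gradient φ).enorm.pow_const 2).indicator hU.measurableSet
  have hhG : ∫⁻ x, h x ≤ G := by
    rw [lintegral_indicator hU.measurableSet]
    exact lintegral_mono_set hUΩ
  have hφm : AEMeasurable φ (volume.restrict U) :=
    (hφ.continuousOn.mono hUΩ).aemeasurable hU.measurableSet
  have hFm : AEMeasurable (fun y => ∫⁻ x in U, ‖φ x - φ y‖ₑ ^ 2) (volume.restrict U) :=
    AEMeasurable.lintegral_prod_right' (f := fun p : Plane × Plane => ‖φ p.2 - φ p.1‖ₑ ^ 2)
      ((hφm.comp_snd.sub hφm.comp_fst).enorm.pow_const 2)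
  -- The constant is a value `φ y`, at a `y` where the squared distance of `φ` to `φ y` is at most
  -- its average over `U`.
  obtain ⟨y, -, hy⟩ := exists_le_setLAverage hvol0 hvol hFm
  refine ⟨φ y, hy.trans ?_⟩
  rw [setLAverage_eq]
  refine ENNReal.div_le_of_le_mul ?_
  calc ∫⁻ y in U, ∫⁻ x in U, ‖φ x - φ y‖ₑ ^ 2
      ≤ ∫⁻ y in U, ∫⁻ x in U, d ^ 2 * ∫⁻ t in Icc (0 : ℝ) 1, h (y + t • (x - y)) := by
        refine lintegral_mono_ae ?_
        filter_upwards [ae_restrict_of_ae (hφ.enorm_sub_sq_le hconv hUΩ hd),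
          ae_restrict_mem hU.measurableSet] with y hy hyU
        refine setLIntegral_mono' hU.measurableSet fun x hx => (hy hyU x hx).trans ?_
        gcongr 1
        refine setLIntegral_mono' measurableSet_Icc fun t ht => ?_
        simp only [h]
        rw [indicator_of_mem (hconv.add_smul_sub_mem hyU hx ht)]
    _ = d ^ 2 * ∫⁻ y in U, ∫⁻ x in U, ∫⁻ t in Icc (0 : ℝ) 1, h (y + t • (x - y)) := by
        rw [← lintegral_const_mul' _ _ (by finiteness)]
        refine lintegral_congr fun y => ?_
        rw [lintegral_const_mul' _ _ (by finiteness)]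
    _ = d ^ 2 * ∫⁻ t in Icc (0 : ℝ) 1, ∫⁻ y in U, ∫⁻ x in U, h (y + t • (x - y)) := by
        congr 1
        calc ∫⁻ y in U, ∫⁻ x in U, ∫⁻ t in Icc (0 : ℝ) 1, h (y + t • (x - y))
            = ∫⁻ y in U, ∫⁻ t in Icc (0 : ℝ) 1, ∫⁻ x in U, h (y + t • (x - y)) := by
              refine lintegral_congr fun y => lintegral_lintegral_swap ?_
              exact (hh.comp (by fun_prop : Measurable fun p : Plane × ℝ =>
                y + p.2 • (p.1 - y))).aemeasurable
          _ = _ := by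
              refine lintegral_lintegral_swap (Measurable.aemeasurable ?_)
              exact Measurable.lintegral_prod_right'
                (f := fun q : (Plane × ℝ) × Plane => h (q.1.1 + q.1.2 • (q.2 - q.1.1)))
                (hh.comp (by fun_prop))
    _ ≤ d ^ 2 * ∫⁻ t in Icc (0 : ℝ) 1, volume U * (4 * G) := by
        gcongr with t
        exact (lintegral_lintegral_segment_le hh t).trans (by gcongr)
    _ = ((d ^ 2 * 4 : ℝ≥0) : ℝ≥0∞) * G * volume U := by
        simp only [setLIntegral_const, Real.volume_Icc]
        push_cast
        simp
        ring

/-! ### Gluing Poincaré inequalities -/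

theorem enorm_sub_sq_le_two_mul (a b c : ℝ) :
    ‖a - c‖ₑ ^ 2 ≤ 2 * ‖a - b‖ₑ ^ 2 + 2 * ‖b - c‖ₑ ^ 2 := by
  have h : ∀ r : ℝ, ‖r‖ₑ ^ 2 = ENNReal.ofReal (r ^ 2) := fun r => by
    rw [← ofReal_norm, ← ENNReal.ofReal_pow (norm_nonneg r), Real.norm_eq_abs, sq_abs]
  have h2 : (2 : ℝ≥0∞) = ENNReal.ofReal 2 := by norm_num
  rw [h, h, h, h2, ← ENNReal.ofReal_mul zero_le_two, ← ENNReal.ofReal_mul zero_le_two,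
    ← ENNReal.ofReal_add (by positivity) (by positivity)]
  refine ENNReal.ofReal_le_ofReal ?_
  nlinarith [sq_nonneg (a - b - (b - c))]

/-- The overlap has positive measure, so the constants `c` and `e` of the two sets can be compared
there through `φ`. The ratio `r` carries the bound on `e - c` from the overlap to `W`. -/
theorem PoincareOn.union {Ω U W : Set Plane} (hU : PoincareOn Ω U) (hW : PoincareOn Ω W)
    (hUo : IsOpen U) (hWo : IsOpen W) (hWΩ : W ⊆ Ω) (hne : (U ∩ W).Nonempty)
    (hb : Bornology.IsBounded Ω) : PoincareOn Ω (U ∪ W) := by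
  obtain ⟨C₁, hC₁⟩ := hU
  obtain ⟨C₂, hC₂⟩ := hW
  set r : ℝ≥0 := (volume W / volume (U ∩ W)).toNNReal
  have hO0 : volume (U ∩ W) ≠ 0 := ((hUo.inter hWo).measure_pos volume hne).ne'
  have hW' : volume W ≠ ∞ := (hb.subset hWΩ).measure_lt_top.ne
  have hO : volume (U ∩ W) ≠ ∞ := measure_ne_top_of_subset inter_subset_right hW'
  have hr : (r : ℝ≥0∞) = volume W / volume (U ∩ W) :=
    ENNReal.coe_toNNReal (ENNReal.div_ne_top hW' hO0)
  have hvol : volume W = volume (U ∩ W) * r := by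
    rw [hr, ENNReal.mul_div_cancel hO0 hO]
  refine ⟨C₁ + (2 * C₂ + 2 * ((2 * C₁ + 2 * C₂) * r)), fun φ hφ => ?_⟩
  obtain ⟨c, hc⟩ := hC₁ φ hφ
  obtain ⟨e, he⟩ := hC₂ φ hφ
  set G := ∫⁻ x in Ω, ‖gradient φ x‖ₑ ^ 2
  have hm : ∀ (b : ℝ) (S : Set Plane), IsOpen S → S ⊆ Ω →
      AEMeasurable (fun x => 2 * ‖φ x - b‖ₑ ^ 2) (volume.restrict S) := fun b S hS hSΩ =>
    ((((hφ.continuousOn.mono hSΩ).aemeasurable hS.measurableSet).sub_const b).enorm.pow_const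
      2).const_mul 2
  have hce : ‖e - c‖ₑ ^ 2 * volume (U ∩ W) ≤ (2 * C₁ + 2 * C₂) * G := by
    calc ‖e - c‖ₑ ^ 2 * volume (U ∩ W) = ∫⁻ x in U ∩ W, ‖e - c‖ₑ ^ 2 := by
          rw [setLIntegral_const]
      _ ≤ ∫⁻ x in U ∩ W, (2 * ‖φ x - e‖ₑ ^ 2 + 2 * ‖φ x - c‖ₑ ^ 2) := by
          refine lintegral_mono fun x => ?_
          rw [← enorm_neg (φ x - e), neg_sub]
          exact enorm_sub_sq_le_two_mul _ _ _
      _ = (2 * ∫⁻ x in U ∩ W, ‖φ x - e‖ₑ ^ 2) + 2 * ∫⁻ x in U ∩ W, ‖φ x - c‖ₑ ^ 2 := by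
          rw [lintegral_add_left' (hm e _ (hUo.inter hWo) (inter_subset_right.trans hWΩ)),
            lintegral_const_mul' _ _ (by simp), lintegral_const_mul' _ _ (by simp)]
      _ ≤ 2 * (C₂ * G) + 2 * (C₁ * G) := by
          gcongr
          · exact (lintegral_mono_set inter_subset_right).trans he
          · exact (lintegral_mono_set inter_subset_left).trans hc
      _ = (2 * C₁ + 2 * C₂) * G := by ring
  refine ⟨c, (lintegral_union_le _ _ _).trans ?_⟩
  have hWc : ∫⁻ x in W, ‖φ x - c‖ₑ ^ 2 ≤ 2 * (C₂ * G) + 2 * ((2 * C₁ + 2 * C₂) * G * r) := by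
    calc ∫⁻ x in W, ‖φ x - c‖ₑ ^ 2
        ≤ ∫⁻ x in W, (2 * ‖φ x - e‖ₑ ^ 2 + 2 * ‖e - c‖ₑ ^ 2) :=
          lintegral_mono fun x => enorm_sub_sq_le_two_mul _ _ _
      _ = (2 * ∫⁻ x in W, ‖φ x - e‖ₑ ^ 2) + 2 * (‖e - c‖ₑ ^ 2 * volume (U ∩ W) * r) := by
          rw [lintegral_add_left' (hm e W hWo hWΩ), lintegral_const_mul' _ _ (by simp),
            setLIntegral_const, hvol]
          ring
      _ ≤ _ := by gcongr
  calc _ ≤ C₁ * G + (2 * (C₂ * G) + 2 * ((2 * C₁ + 2 * C₂) * G * r)) := add_le_add hc hWc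
    _ = _ := by
      push_cast
      ring

/-- The points reached by such a `W` form an open set that is closed relative to `Ω`: a ball in `Ω`
around a limit point meets some `W` and can be glued to it. -/
theorem exists_poincareOn_of_isPreconnected {Ω U : Set Plane} (hΩ : IsOpen Ω)
    (hconn : IsPreconnected Ω) (hb : Bornology.IsBounded Ω) (hU : IsOpen U) (hne : U.Nonempty)
    (hUΩ : U ⊆ Ω) (hP : PoincareOn Ω U) {x : Plane} (hx : x ∈ Ω) :
    ∃ W, IsOpen W ∧ U ⊆ W ∧ W ⊆ Ω ∧ x ∈ W ∧ PoincareOn Ω W := by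
  set A : Set Plane := {x | ∃ W, IsOpen W ∧ U ⊆ W ∧ W ⊆ Ω ∧ x ∈ W ∧ PoincareOn Ω W}
  have hAo : IsOpen A := by
    rw [isOpen_iff_forall_mem_open]
    rintro x ⟨W, hW, hUW, hWΩ, hxW, hPW⟩
    exact ⟨W, fun y hy => ⟨W, hW, hUW, hWΩ, hy, hPW⟩, hW, hxW⟩
  obtain ⟨u, hu⟩ := hne
  have hA : (Ω ∩ A).Nonempty := ⟨u, hUΩ hu, U, hU, Subset.rfl, hUΩ, hu, hP⟩
  refine hconn.subset_of_closure_inter_subset hAo hA ?_ hx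
  rintro y ⟨hyA, hyΩ⟩
  obtain ⟨r, hr, hrΩ⟩ := Metric.isOpen_iff.1 hΩ y hyΩ
  obtain ⟨z, hzA, hz⟩ := Metric.mem_closure_iff.1 hyA r hr
  obtain ⟨W, hW, hUW, hWΩ, hzW, hPW⟩ := hzA
  have hzb : z ∈ Metric.ball y r := by rwa [Metric.mem_ball, dist_comm]
  refine ⟨W ∪ Metric.ball y r, hW.union Metric.isOpen_ball, hUW.trans subset_union_left,
    union_subset hWΩ hrΩ, Or.inr (Metric.mem_ball_self hr), ?_⟩
  exact hPW.union (poincareOn_of_convex Metric.isOpen_ball (convex_ball y r)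
    ⟨y, Metric.mem_ball_self hr⟩ Metric.isBounded_ball hrΩ) hW Metric.isOpen_ball hrΩ
    ⟨z, hzW, hzb⟩ hb

/-- The Poincaré inequality on a bounded domain whose boundary lies on finitely many lines. -/
theorem poincareOn_of_frontier_subset_lineUnion {Ω : Set Plane} (hΩ : IsOpen Ω)
    (hconn : IsConnected Ω) (hb : Bornology.IsBounded Ω)
    {T : Finset ((Plane →L[ℝ] ℝ) × ℝ)} (hT0 : ∀ p ∈ T, p.1 ≠ 0)
    (hT : frontier Ω ⊆ lineUnion T) : PoincareOn Ω Ω := by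
  obtain ⟨P, hPfin, hP, hcover⟩ := exists_convex_cells hΩ hT
  obtain ⟨x₀, hx₀⟩ := hconn.nonempty
  obtain ⟨r, hr, hrΩ⟩ := Metric.isOpen_iff.1 hΩ x₀ hx₀
  set B := Metric.ball x₀ r
  have hx₀B : x₀ ∈ B := Metric.mem_ball_self hr
  have hPB : PoincareOn Ω B := poincareOn_of_convex Metric.isOpen_ball (convex_ball x₀ r)
    ⟨x₀, hx₀B⟩ Metric.isBounded_ball hrΩ
  obtain ⟨W, hW, -, hWΩ, hPW, hcW⟩ : ∃ W, IsOpen W ∧ x₀ ∈ W ∧ W ⊆ Ω ∧ PoincareOn Ω W ∧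
      ⋃₀ P ⊆ W := by
    clear hcover
    induction P, hPfin using Set.Finite.induction_on with
    | empty => exact ⟨B, Metric.isOpen_ball, hx₀B, hrΩ, hPB, by simp⟩
    | @insert V Q _ _ ih =>
      obtain ⟨W, hW, hxW, hWΩ, hPW, hQW⟩ := ih fun U hU => hP U (mem_insert_of_mem _ hU)
      obtain ⟨hVo, hVc, ⟨v, hv⟩, hVΩ⟩ := hP V (mem_insert _ _)
      -- `Z` bridges the base ball and the new cell: it overlaps `W` at `x₀` and `V` at `v`.
      obtain ⟨Z, hZ, hBZ, hZΩ, hvZ, hPZ⟩ := exists_poincareOn_of_isPreconnected hΩ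
        hconn.isPreconnected hb Metric.isOpen_ball ⟨x₀, hx₀B⟩ hrΩ hPB (hVΩ hv)
      have hPV : PoincareOn Ω V := poincareOn_of_convex hVo hVc ⟨v, hv⟩ (hb.subset hVΩ) hVΩ
      refine ⟨W ∪ (Z ∪ V), hW.union (hZ.union hVo), Or.inl hxW,
        union_subset hWΩ (union_subset hZΩ hVΩ), ?_, ?_⟩
      · exact hPW.union (hPZ.union hPV hZ hVo hVΩ ⟨v, hvZ, hv⟩ hb) hW (hZ.union hVo)
          (union_subset hZΩ hVΩ) ⟨x₀, hxW, Or.inl (hBZ hx₀B)⟩ hb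
      · rw [sUnion_insert]
        exact union_subset (subset_union_right.trans subset_union_right)
          (hQW.trans subset_union_left)
  obtain ⟨C, hC⟩ := hPW
  refine ⟨C, fun φ hφ => ?_⟩
  obtain ⟨c, hc⟩ := hC φ hφ
  refine ⟨c, le_trans ?_ hc⟩
  calc ∫⁻ x in Ω, ‖φ x - c‖ₑ ^ 2 ≤ ∫⁻ x in W ∪ lineUnion T, ‖φ x - c‖ₑ ^ 2 :=
        lintegral_mono_set (hcover.trans (union_subset_union_left _ hcW))
    _ ≤ _ := lintegral_union_le _ _ _
    _ = ∫⁻ x in W, ‖φ x - c‖ₑ ^ 2 := by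
        rw [setLIntegral_measure_zero _ _ (volume_lineUnion hT0), add_zero]

theorem IsMesh.isBounded {Ω : Set Plane} {M : Set (Set Plane)} (hM : IsMesh Ω M) :
    Bornology.IsBounded Ω := by
  have h : Bornology.IsBounded (⋃₀ M) :=
    (Bornology.isBounded_sUnion hM.finite).2 fun E hE => (hM.polygon E hE).compact.isBounded
  rw [hM.cover] at h
  exact h.subset subset_closure

theorem IsMesh.poincareOn {Ω : Set Plane} {M : Set (Set Plane)} (hM : IsMesh Ω M)
    (hΩ : IsOpen Ω) (hconn : IsConnected Ω) : PoincareOn Ω Ω := by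
  obtain ⟨T, hT0, hT⟩ := hM.exists_frontier_subset_lineUnion
  exact poincareOn_of_frontier_subset_lineUnion hΩ hconn hM.isBounded hT0
    (hM.polygonal_boundary.trans (iUnion₂_subset hT))

/-! ### Elementwise polynomials -/

theorem analyticOnNhd_eval_plane (p : MvPolynomial (Fin 2) ℝ) (s : Set Plane) :
    AnalyticOnNhd ℝ (fun x : Plane => MvPolynomial.eval (fun i => x i) p) s :=
  (AnalyticOnNhd.eval_continuousLinearMap
    (EuclideanSpace.equiv (Fin 2) ℝ : Plane →L[ℝ] (Fin 2 → ℝ)) p).mono (subset_univ s)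

theorem IsMesh.ae_mem_interior {Ω : Set Plane} {M : Set (Set Plane)} (hM : IsMesh Ω M) :
    ∀ᵐ x, x ∈ Ω → ∃ E ∈ M, x ∈ interior E := by
  obtain ⟨T, hT0, hT⟩ := hM.exists_frontier_subset_lineUnion
  have hN : ∀ᵐ x, x ∉ lineUnion T := compl_mem_ae_iff.2 (volume_lineUnion hT0)
  filter_upwards [hN] with x hxT hx
  obtain ⟨E, hE, hxE⟩ : x ∈ ⋃₀ M := hM.cover ▸ subset_closure hx
  exact ⟨E, hE, by_contra fun h => hxT (hT E hE ⟨subset_closure hxE, h⟩)⟩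

theorem IsElementwisePoly.exists_bound {Ω : Set Plane} {M : Set (Set Plane)} {ψ : Plane → ℝ}
    (hψ : IsElementwisePoly M ψ) (hM : IsMesh Ω M) :
    ∃ K : ℝ, ∀ E ∈ M, ∀ x ∈ interior E, ‖ψ x‖ ≤ K := by
  have h : ∀ E : M, ∃ K : ℝ, ∀ x ∈ interior (E : Set Plane), ‖ψ x‖ ≤ K := by
    rintro ⟨E, hE⟩
    obtain ⟨p, hp⟩ := hψ E hE
    obtain ⟨K, hK⟩ := (hM.polygon E hE).compact.exists_bound_of_continuousOn
      (analyticOnNhd_eval_plane p E).continuousOn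
    exact ⟨K, fun x hx => by rw [hp x hx]; exact hK x (interior_subset hx)⟩
  choose K hK using h
  have := hM.finite.to_subtype
  obtain ⟨B, hB⟩ := (Set.finite_range K).bddAbove
  exact ⟨B, fun E hE x hx => (hK ⟨E, hE⟩ x hx).trans (hB (mem_range_self _))⟩

theorem IsElementwisePoly.memLp {Ω : Set Plane} {M : Set (Set Plane)} {ψ : Plane → ℝ}
    (hψ : IsElementwisePoly M ψ) (hM : IsMesh Ω M) (hΩ : IsOpen Ω) :
    MemLp ψ 2 (volume.restrict Ω) := by
  have hfin : IsFiniteMeasure (volume.restrict Ω) :=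
    ⟨by simpa using hM.isBounded.measure_lt_top⟩
  have := hM.finite.to_subtype
  obtain ⟨K, hK⟩ := hψ.exists_bound hM
  have hmeas : AEStronglyMeasurable ψ (volume.restrict (⋃ E : M, interior (E : Set Plane))) := by
    refine aestronglyMeasurable_iUnion_iff.2 fun E => ?_
    obtain ⟨p, hp⟩ := hψ E E.2
    exact ((analyticOnNhd_eval_plane p _).continuousOn.congr hp).aestronglyMeasurable
      isOpen_interior.measurableSet
  refine MemLp.of_bound (hmeas.mono_measure (Measure.restrict_mono_ae ?_)) K ?_
  · filter_upwards [hM.ae_mem_interior] with x hx hxΩ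
    obtain ⟨E, hE, hxE⟩ := hx hxΩ
    exact mem_iUnion.2 ⟨⟨E, hE⟩, hxE⟩
  · filter_upwards [ae_restrict_of_ae hM.ae_mem_interior, ae_restrict_mem hΩ.measurableSet]
      with x hx hxΩ
    obtain ⟨E, hE, hxE⟩ := hx hxΩ
    exact hK E hE x hxE

/-- The embedding supplies the gradient bound: `∇φ` agrees inside elements with a field of `V`,
whose components are polynomials on finitely many compact elements. -/
theorem IsFiniteElementPair.hasPiecewiseGradient {Ω : Set Plane} {M : Set (Set Plane)}
    {H : Submodule ℝ (Plane → ℝ)} {V : Submodule ℝ (Plane → Plane)}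
    (hHV : IsFiniteElementPair Ω M H V) (hM : IsMesh Ω M) (hV : GradientEmbeds M H V)
    {φ : Plane → ℝ} (hφ : φ ∈ H) : HasPiecewiseGradient Ω φ := by
  obtain ⟨T, hT0, hT⟩ := hM.exists_frontier_subset_lineUnion
  obtain ⟨q, hq, hqφ⟩ := hV φ hφ
  obtain ⟨K₀, hK₀⟩ := (hHV.velocity_poly q hq 0).exists_bound hM
  obtain ⟨K₁, hK₁⟩ := (hHV.velocity_poly q hq 1).exists_bound hM
  refine ⟨hHV.pressure_continuous φ hφ, T, hT0, √(K₀ ^ 2 + K₁ ^ 2), fun x hx hxT => ?_⟩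
  obtain ⟨E, hE, hxE⟩ : x ∈ ⋃₀ M := hM.cover ▸ subset_closure hx
  have hxi : x ∈ interior E := by_contra fun h => hxT (hT E hE ⟨subset_closure hxE, h⟩)
  constructor
  · obtain ⟨p, hp⟩ := hHV.pressure_poly φ hφ E hE
    exact (analyticOnNhd_eval_plane p {x} x rfl).differentiableAt.congr_of_eventuallyEq
      (Filter.eventuallyEq_of_mem (isOpen_interior.mem_nhds hxi) hp)
  · rw [← hqφ E hE x hxi, EuclideanSpace.norm_eq, Fin.sum_univ_two]
    gcongr
    · exact hK₀ E hE x hxi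
    · exact hK₁ E hE x hxi

/-! ### Norms and the inf-sup condition -/

theorem integrable_norm_sq {F : Type*} [NormedAddCommGroup F] {α : Type*} [MeasurableSpace α]
    {μ : Measure α} {f : α → F} (hf : MemLp f 2 μ) : Integrable (fun x => ‖f x‖ ^ 2) μ := by
  simpa using hf.integrable_norm_pow two_ne_zero

theorem lintegral_enorm_sq {F : Type*} [NormedAddCommGroup F] {α : Type*} [MeasurableSpace α]
    {μ : Measure α} {f : α → F} (hf : MemLp f 2 μ) :
    ∫⁻ x, ‖f x‖ₑ ^ 2 ∂μ = ENNReal.ofReal (∫ x, ‖f x‖ ^ 2 ∂μ) := by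
  rw [ofReal_integral_eq_lintegral_ofReal (integrable_norm_sq hf)
    (Filter.Eventually.of_forall fun x => by positivity)]
  refine lintegral_congr fun x => ?_
  rw [ENNReal.ofReal_pow (norm_nonneg _), ofReal_norm]

theorem integral_inner_le_l2Norm_mul {Ω : Set Plane} {w g : Plane → Plane}
    (hw : MemLp w 2 (volume.restrict Ω)) (hg : MemLp g 2 (volume.restrict Ω)) :
    ∫ x in Ω, ⟪w x, g x⟫ ≤ l2Norm Ω w * l2Norm Ω g := by
  have hprod : Integrable (fun x => ‖w x‖ * ‖g x‖) (volume.restrict Ω) :=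
    hw.norm.integrable_mul hg.norm
  have h := integral_mul_le_Lp_mul_Lq_of_nonneg (μ := volume.restrict Ω)
    Real.HolderConjugate.two_two (f := fun x => ‖w x‖) (g := fun x => ‖g x‖)
    (Filter.Eventually.of_forall fun x => norm_nonneg _)
    (Filter.Eventually.of_forall fun x => norm_nonneg _)
    (by simpa using hw.norm) (by simpa using hg.norm)
  calc ∫ x in Ω, ⟪w x, g x⟫ ≤ ∫ x in Ω, ‖w x‖ * ‖g x‖ := by
        have hle : ∀ x, ⟪w x, g x⟫ ≤ ‖w x‖ * ‖g x‖ := fun x => real_inner_le_norm _ _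
        refine integral_mono (hprod.mono' (hw.aestronglyMeasurable.inner hg.aestronglyMeasurable)
          (Filter.Eventually.of_forall fun x => norm_inner_le_norm _ _)) hprod hle
    _ ≤ _ := h
    _ = l2Norm Ω w * l2Norm Ω g := by
        simp only [l2Norm, Real.sqrt_eq_rpow, Real.rpow_two]

/-- Expanding the square about the mean, the cross term integrates to zero. -/
theorem integral_sub_average_sq_le {α : Type*} [MeasurableSpace α] {μ : Measure α}
    [IsFiniteMeasure μ] {f : α → ℝ} (hf : MemLp f 2 μ) (c : ℝ) :
    ∫ x, ‖f x - ⨍ y, f y ∂μ‖ ^ 2 ∂μ ≤ ∫ x, ‖f x - c‖ ^ 2 ∂μ := by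
  set m := ⨍ y, f y ∂μ
  have hm : MemLp (fun x => f x - m) 2 μ := hf.sub (memLp_const m)
  have h0 : ∫ x, (f x - m) ∂μ = 0 := integral_sub_average μ f
  have hexp : ∀ x, ‖f x - c‖ ^ 2 = ‖f x - m‖ ^ 2 + (2 * (m - c) * (f x - m) + (m - c) ^ 2) := by
    intro x
    simp only [Real.norm_eq_abs, sq_abs]
    ring
  have hi : Integrable (fun x => 2 * (m - c) * (f x - m)) μ :=
    (hm.integrable one_le_two).const_mul _
  have hj : Integrable (fun x => 2 * (m - c) * (f x - m) + (m - c) ^ 2) μ :=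
    hi.add (integrable_const _)
  simp_rw [hexp]
  rw [integral_add (integrable_norm_sq hm) hj,
    integral_add hi (integrable_const _), integral_const_mul, h0, mul_zero, zero_add]
  have : 0 ≤ ∫ _, (m - c) ^ 2 ∂μ := integral_nonneg fun _ => sq_nonneg _
  linarith

theorem theorem3p5 (Ω : Set Plane) (hΩ_open : IsOpen Ω) (hΩ_connected : IsConnected Ω) :
    ∃ β : ℝ, 0 < β ∧
      ∀ (M : Set (Set Plane)) (H : Submodule ℝ (Plane → ℝ)) (V : Submodule ℝ (Plane → Plane)),
        IsMesh Ω M → IsFiniteElementPair Ω M H V → GradientEmbeds M H V →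
          InfSupCondition Ω H V β := by
  -- `β` must precede the mesh. One reference mesh yields a Poincaré constant depending on `Ω`
  -- alone; without any mesh the claim is vacuous.
  by_cases hmesh : ∃ M, IsMesh Ω M
  swap
  · exact ⟨1, one_pos, fun M _ _ hM => (hmesh ⟨M, hM⟩).elim⟩
  obtain ⟨M₀, hM₀⟩ := hmesh
  obtain ⟨C, hC⟩ := hM₀.poincareOn hΩ_open hΩ_connected
  -- The added `1` keeps the denominator positive when `C = 0`.
  refine ⟨1 / (√C + 1), by positivity, fun M H V hM hHV hV φ hφ => ?_⟩
  have hfin : IsFiniteMeasure (volume.restrict Ω) :=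
    ⟨by simpa using hM.isBounded.measure_lt_top⟩
  have hVL : ∀ w ∈ V, MemLp w 2 (volume.restrict Ω) := fun w hw =>
    MemLp.of_eval_piLp fun i => (hHV.velocity_poly w hw i).memLp hM hΩ_open
  obtain ⟨q, hq, hqφ⟩ := hV φ hφ
  have hqae : q =ᵐ[volume.restrict Ω] gradient φ := by
    filter_upwards [ae_restrict_of_ae hM.ae_mem_interior, ae_restrict_mem hΩ_open.measurableSet]
      with x hx hxΩ
    obtain ⟨E, hE, hxE⟩ := hx hxΩ
    exact hqφ E hE x hxE
  have hgL : MemLp (gradient φ) 2 (volume.restrict Ω) := (memLp_congr_ae hqae).1 (hVL q hq)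
  have hbdd : BddAbove (range fun w : V => infSupQuotient Ω φ (w : Plane → Plane)) := by
    refine ⟨l2Norm Ω (gradient φ), ?_⟩
    rintro _ ⟨w, rfl⟩
    refine div_le_of_le_mul₀ (Real.sqrt_nonneg _) (Real.sqrt_nonneg _) ?_
    rw [mul_comm]
    exact integral_inner_le_l2Norm_mul (hVL w w.2) hgL
  refine ⟨hbdd, le_trans ?_ (le_ciSup hbdd ⟨q, hq⟩)⟩
  have hquot : infSupQuotient Ω φ q = l2Norm Ω (gradient φ) := by
    have h1 : ∫ x in Ω, ⟪q x, gradient φ x⟫ = ∫ x in Ω, ‖gradient φ x‖ ^ 2 := by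
      refine integral_congr_ae ?_
      filter_upwards [hqae] with x hx
      rw [hx, real_inner_self_eq_norm_sq]
    have h2 : ∫ x in Ω, ‖q x‖ ^ 2 = ∫ x in Ω, ‖gradient φ x‖ ^ 2 := by
      refine integral_congr_ae ?_
      filter_upwards [hqae] with x hx
      rw [hx]
    -- `a / √a = √a` also holds at `a = 0`, which covers a vanishing gradient.
    rw [infSupQuotient, l2Norm, l2Norm, h1, h2, Real.div_sqrt]
  rw [hquot]
  obtain ⟨c, hc⟩ := hC φ (hHV.hasPiecewiseGradient hM hV hφ)
  have hφL : MemLp φ 2 (volume.restrict Ω) := (hHV.pressure_poly φ hφ).memLp hM hΩ_open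
  have hφc : MemLp (fun x => φ x - c) 2 (volume.restrict Ω) := hφL.sub (memLp_const c)
  rw [lintegral_enorm_sq hφc, lintegral_enorm_sq hgL, ← ENNReal.ofReal_coe_nnreal,
    ← ENNReal.ofReal_mul C.coe_nonneg, ENNReal.ofReal_le_ofReal_iff (mul_nonneg C.coe_nonneg
      (integral_nonneg fun x => by positivity))] at hc
  have hpoinc : l2Norm Ω (fun x => φ x - ⨍ y in Ω, φ y) ≤ √C * l2Norm Ω (gradient φ) := by
    rw [l2Norm, l2Norm, ← Real.sqrt_mul C.coe_nonneg]
    exact Real.sqrt_le_sqrt ((integral_sub_average_sq_le hφL c).trans hc)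
  rw [one_div, inv_mul_le_iff₀ (by positivity)]
  have : 0 ≤ l2Norm Ω (gradient φ) := Real.sqrt_nonneg _
  linarith
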